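/- **Definitions.** A metric space $X$ is *finitely injective* if, for all finite metric spaces $K\subseteq L$ with $\operatorname{diam}(L)\le\operatorname{diam}(X)$ (diameters taken in $[0,\infty]$), every isometric embedding $K\to X$ extends to an isometric embedding $L\to X$. The *Urysohn space* $\mathbb U$ is the complete separable, finitely injective metric space of infinite diameter (unique up to isometry). Its group of isometries $G=\operatorname{Iso}(\mathbb U)$ carries the topology of pointwise convergence; it is a topological group acting continuously on $\mathbb U$. An *equivariant compactification* of a $G$-space $X$ is a continuous $G$-equivariant map $\nu\colon X\to K$ with dense image into a compact Hausdorff space $K$ on which $G$ acts (jointly) continuously; $\nu$ is not required to be injective. It is the *greatest* one if every equivariant compactification $\mu\colon X\to L$ factors as $\mu=\pi\circ\nu$ for a continuous $G$-equivariant map $\pi\colon K\to L$ (this determines $\nu$ up to equivalence). For a metric space $(X,d)$, let $\mathcal U_{w,d}$ be the initial uniformity on $X$ for the family of functions $x\mapsto d(x,z)$, $z\in X$. The *Gromov compactification* $\gamma\colon X\to\gamma X$ is the Samuel compactification of $(X,\mathcal U_{w,d})$, that is, the completion of $X$ with respect to the finest totally bounded uniformity on $X$ coarser than $\mathcal U_{w,d}$.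 **Theorem.** Let $\mathbb U$ be the Urysohn space and $G=\operatorname{Iso}(\mathbb U)$. Then $\gamma\mathbb U$ carries a $G$-action for which $\gamma\colon\mathbb U\to\gamma\mathbb U$ is an equivariant compactification, and it is the greatest equivariant compactification of the $G$-space $\mathbb U$. Moreover, $\gamma\mathbb U$ is not metrizable. -/

import Mathlib

open Topology Uniformity

universe u v

/-! ### The Urysohn space -/

/-- A metric space `X` is finitely injective if for all finite metric spaces `K ⊆ L` of diameter at
most `diam X` (in `[0, ∞]`), every isometric embedding of `K` into `X` extends to an isometric
embedding of `L` into `X`. -/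
def IsFinitelyInjective (X : Type u) [MetricSpace X] : Prop :=
  ∀ (L : Type u) [MetricSpace L] [Finite L] (K : Set L),
    Metric.ediam (Set.univ : Set L) ≤ Metric.ediam (Set.univ : Set X) →
    ∀ φ : K → X, Isometry φ → ∃ Φ : L → X, Isometry Φ ∧ ∀ k : K, Φ k = φ k

/-- `X` is (a copy of) the Urysohn space: a complete separable, finitely injective metric space of
infinite diameter. These properties determine `X` up to isometry. -/
structure IsUrysohnSpace (X : Type u) [MetricSpace X] : Prop where
  complete : CompleteSpace X
  separable : TopologicalSpace.SeparableSpace X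
  finitelyInjective : IsFinitelyInjective X
  ediam_eq_top : Metric.ediam (Set.univ : Set X) = ⊤

/-! ### The isometry group with the topology of pointwise convergence -/

section IsometryGroup

variable {X : Type u} [MetricSpace X]

/-- The topology of pointwise convergence on the group `X ≃ᵢ X` of all isometries of `X`. -/
instance isoPointwiseTopology : TopologicalSpace (X ≃ᵢ X) :=
  TopologicalSpace.induced (fun (g : X ≃ᵢ X) (x : X) => g x) inferInstance

/-- The natural action of the isometry group of `X` on `X`. -/
instance isoMulAction : MulAction (X ≃ᵢ X) X where
  smul g x := g x
  one_smul _ := rfl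
  mul_smul _ _ _ := rfl

theorem iso_smul_def (g : X ≃ᵢ X) (x : X) : g • x = g x := rfl

theorem iso_continuous_apply (x : X) : Continuous fun g : X ≃ᵢ X => g x :=
  (continuous_apply x).comp continuous_induced_dom

theorem iso_tendsto_iff {α : Type*} {l : Filter α} {f : α → (X ≃ᵢ X)} {g : X ≃ᵢ X} :
    Filter.Tendsto f l (𝓝 g) ↔ ∀ x, Filter.Tendsto (fun a => f a x) l (𝓝 (g x)) := by
  rw [nhds_induced, Filter.tendsto_comap_iff, tendsto_pi_nhds]
  rfl

instance isoContinuousSMul : ContinuousSMul (X ≃ᵢ X) X where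
  continuous_smul := by
    rw [continuous_iff_continuousAt]
    rintro ⟨g, x⟩
    have h1 : Filter.Tendsto (fun p : (X ≃ᵢ X) × X => p.1 x) (𝓝 (g, x)) (𝓝 (g x)) :=
      ((iso_continuous_apply x).comp continuous_fst).tendsto (g, x)
    have h2 : Filter.Tendsto (fun p : (X ≃ᵢ X) × X => dist (p.1 x) (p.1 p.2)) (𝓝 (g, x))
        (𝓝 0) := by
      have h3 : Filter.Tendsto (fun p : (X ≃ᵢ X) × X => dist x p.2) (𝓝 (g, x))
          (𝓝 (dist x x)) :=
        (continuous_const.dist continuous_snd).tendsto (g, x)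
      simpa [IsometryEquiv.dist_eq] using h3
    exact h1.congr_dist h2

instance isoIsTopologicalGroup : IsTopologicalGroup (X ≃ᵢ X) where
  continuous_mul := by
    rw [continuous_iff_continuousAt]
    rintro ⟨g, h⟩
    refine iso_tendsto_iff.2 fun x => ?_
    have h1 : Continuous fun p : (X ≃ᵢ X) × (X ≃ᵢ X) => p.1 • (p.2 x) :=
      continuous_fst.smul ((iso_continuous_apply x).comp continuous_snd)
    exact h1.tendsto (g, h)
  continuous_inv := by
    rw [continuous_iff_continuousAt]
    intro g
    refine iso_tendsto_iff.2 fun x => ?_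
    rw [tendsto_iff_dist_tendsto_zero]
    have h1 : Continuous fun h : X ≃ᵢ X => dist x (h (g⁻¹ x)) :=
      continuous_const.dist (iso_continuous_apply _)
    have h2 : Filter.Tendsto (fun h : X ≃ᵢ X => dist x (h (g⁻¹ x))) (𝓝 g) (𝓝 0) := by
      simpa using h1.tendsto g
    refine h2.congr fun h => ?_
    rw [← h.dist_eq (h⁻¹ x), IsometryEquiv.apply_inv_self]

end IsometryGroup

/-! ### Equivariant compactifications -/

/-- An equivariant compactification of the `G`-space `X`: a compact Hausdorff `G`-space `K`
(the action being jointly continuous) together with a continuous `G`-equivariant map `ν : X → K`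
with dense image. The map `ν` need not be injective. -/
structure IsEquivariantCompactification
    (G : Type*) [Group G] [TopologicalSpace G] [IsTopologicalGroup G]
    {X : Type*} [TopologicalSpace X] [MulAction G X] [ContinuousSMul G X]
    {K : Type*} [TopologicalSpace K] [MulAction G K] (ν : X → K) : Prop where
  compact : CompactSpace K
  hausdorff : T2Space K
  continuous_action : ContinuousSMul G K
  continuous : Continuous ν
  denseRange : DenseRange ν
  equivariant : ∀ (g : G) (x : X), ν (g • x) = g • ν x

/-- The equivariant compactification `ν : X → K` is the greatest one: every equivariant
compactification `μ : X → L` of `X` (with `L` in the universe `v`) factors through `ν`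
by a continuous equivariant map `K → L`. -/
structure IsGreatestEquivariantCompactification
    (G : Type*) [Group G] [TopologicalSpace G] [IsTopologicalGroup G]
    {X : Type*} [TopologicalSpace X] [MulAction G X] [ContinuousSMul G X]
    {K : Type*} [TopologicalSpace K] [MulAction G K] (ν : X → K) : Prop where
  isEquivariantCompactification : IsEquivariantCompactification G ν
  factors : ∀ (L : Type v) [TopologicalSpace L] [MulAction G L] (μ : X → L),
    IsEquivariantCompactification G μ →
      ∃ π : K → L, Continuous π ∧ (∀ (g : G) (k : K), π (g • k) = g • π k) ∧ ∀ x, π (ν x) = μ x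

/-! ### The Gromov compactification

In Mathlib's order on uniformities, `𝒰 ≤ 𝒱` means that `𝒰` is finer than `𝒱`. -/

/-- The `d`-weak uniformity of a metric space: the initial uniformity for the functions
`x ↦ d(x, z)`, `z ∈ X`. -/
@[reducible]
def weakUniformity (X : Type u) [MetricSpace X] : UniformSpace X :=
  ⨅ z : X, UniformSpace.comap (fun x : X => dist x z) inferInstance

/-- The precompact replica of a uniformity `𝒰`: the finest of the totally bounded uniformities
that are coarser than `𝒰` (see `precompactReplica_isLeast`). -/
@[reducible]
def precompactReplica {X : Type u} (𝒰 : UniformSpace X) : UniformSpace X :=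
  sInf {𝒱 : UniformSpace X | 𝒰 ≤ 𝒱 ∧ @TotallyBounded X 𝒱 Set.univ}

theorem precompactReplica_isLeast {X : Type u} (𝒰 : UniformSpace X) :
    IsLeast {𝒱 : UniformSpace X | 𝒰 ≤ 𝒱 ∧ @TotallyBounded X 𝒱 Set.univ}
      (precompactReplica 𝒰) := by
  refine ⟨⟨le_sInf fun 𝒱 h => h.1, ?_⟩, fun 𝒱 h => sInf_le h⟩
  refine (@totallyBounded_iff_ultrafilter X (precompactReplica 𝒰) Set.univ).2 fun f _ =>
    ⟨f.neBot, ?_⟩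
  have h1 : @uniformity X (precompactReplica 𝒰) =
      ⨅ 𝒱 ∈ {𝒱 : UniformSpace X | 𝒰 ≤ 𝒱 ∧ @TotallyBounded X 𝒱 Set.univ}, @uniformity X 𝒱 := by
    rw [precompactReplica, sInf_eq_iInf]
    simp only [iInf_uniformity]
  rw [h1]
  refine le_iInf₂ fun 𝒱 h => ?_
  exact ((@totallyBounded_iff_ultrafilter X 𝒱 Set.univ).1 h.2 f (by simp)).2

/-- The Samuel compactification of the uniform space `(X, 𝒰)`: the (Hausdorff) completion of
`X` with respect to the precompact replica of `𝒰`. -/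
def SamuelCompactification {X : Type u} (𝒰 : UniformSpace X) : Type u :=
  @UniformSpace.Completion X (precompactReplica 𝒰)

instance samuelCompactificationTopology {X : Type u} (𝒰 : UniformSpace X) :
    TopologicalSpace (SamuelCompactification 𝒰) :=
  (@UniformSpace.Completion.uniformSpace X (precompactReplica 𝒰)).toTopologicalSpace

/-- The canonical map of `X` into its Samuel compactification. -/
def samuelMap {X : Type u} (𝒰 : UniformSpace X) : X → SamuelCompactification 𝒰 :=
  @UniformSpace.Completion.coe' X (precompactReplica 𝒰)

/-- The Gromov compactification of a metric space: the Samuel compactification of the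
`d`-weak uniformity. -/
abbrev GromovCompactification (X : Type u) [MetricSpace X] : Type u :=
  SamuelCompactification (weakUniformity X)

/-- The canonical map `γ : X → γX` of `X` into its Gromov compactification. -/
abbrev gromovMap (X : Type u) [MetricSpace X] : X → GromovCompactification X :=
  samuelMap (weakUniformity X)

/-! ### Extension of finite partial isometries -/

/-! An isometry permutes the functions `d(·, z)`, so it is uniformly continuous for the weak
uniformity and extends to `γU`. Since `|d(gx, z) - d(x, z)| ≤ d(gz, z)` for every `x`, isometries
near `1` move all of `γU` uniformly little, and the action is jointly continuous.

Maximality amounts to uniform continuity of every equivariant compactification `μ : U → L` for the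
weak uniformity. By compactness, isometries moving a suitable finite set `F` by less than `ε`
displace `L` little. If `x` and `y` have nearly equal distances to `F`, then
`exists_isometryEquiv_dist_le` gives such a `g` with `g x = y`, so `μ y = g • μ x` is close to `μ
x`. That lemma combines weighted gluing of two finite metric spaces with ultrahomogeneity of `U`.

For non-metrizability, bounded uniformly continuous functions of `d(·, z)` extend to `γU`; they
prevent points at distances `0, 1, 2, …` from `z` from having a convergent subsequence. -/

/-- Glued spaces and indexed families may identify points, so finite injectivity is needed for
pseudometrics; it follows by passing to the separation quotient. Values of `φ` off `K` play no role.
-/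
theorem IsUrysohnSpace.exists_isometry_extension {U : Type u} [MetricSpace U]
    (hU : IsUrysohnSpace U) {L : Type u} [PseudoMetricSpace L] [Finite L] (K : Set L) (φ : L → U)
    (hφ : ∀ a ∈ K, ∀ b ∈ K, dist (φ a) (φ b) = dist a b) :
    ∃ Φ : L → U, Isometry Φ ∧ ∀ a ∈ K, Φ a = φ a := by
  classical
  let K' : Set (SeparationQuotient L) := SeparationQuotient.mk '' K
  let c : K' → L := fun k => k.2.choose
  have hcK : ∀ k, c k ∈ K := fun k => k.2.choose_spec.1
  have hc : ∀ k : K', SeparationQuotient.mk (c k) = k.1 := fun k => k.2.choose_spec.2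
  have hiso : Isometry fun k : K' => φ (c k) := by
    refine Isometry.of_dist_eq fun k l => ?_
    rw [hφ _ (hcK k) _ (hcK l), ← SeparationQuotient.dist_mk, hc, hc, Subtype.dist_eq]
  have : Finite (SeparationQuotient L) := Quotient.finite _
  obtain ⟨Φ, hΦ, hext⟩ := hU.finitelyInjective (SeparationQuotient L) K'
    (by rw [hU.ediam_eq_top]; exact le_top) _ hiso
  refine ⟨Φ ∘ SeparationQuotient.mk, Isometry.of_dist_eq fun a b => ?_, fun a ha => ?_⟩
  · simp [hΦ.dist_eq, SeparationQuotient.dist_mk]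
  · have h1 := hext ⟨SeparationQuotient.mk a, a, ha, rfl⟩
    simp only [Function.comp_apply]
    rw [h1, ← dist_eq_zero, hφ _ (hcK _) _ ha, ← SeparationQuotient.dist_mk, hc, dist_self]

theorem IsUrysohnSpace.exists_one_point_extension {U : Type u} [MetricSpace U]
    (hU : IsUrysohnSpace U) {ι : Type u} [Finite ι] (p q : ι → U)
    (h : ∀ i j, dist (p i) (p j) = dist (q i) (q j)) (x : U) :
    ∃ y, ∀ i, dist x (p i) = dist y (q i) := by
  let : PseudoMetricSpace (Option ι) := .induced (fun o => o.elim x p) inferInstance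
  have hd : ∀ a b : Option ι, dist a b = dist (a.elim x p) (b.elim x p) := fun _ _ => rfl
  obtain ⟨Φ, hΦ, hext⟩ := hU.exists_isometry_extension (Set.range some)
    (fun o : Option ι => o.elim x q) (by
      rintro _ ⟨i, rfl⟩ _ ⟨j, rfl⟩
      simp [hd, h])
  refine ⟨Φ none, fun i => ?_⟩
  have h1 := hext (some i) ⟨i, rfl⟩
  simp only [Option.elim_some] at h1
  rw [← h1, hΦ.dist_eq, hd]
  rfl

/-! ### Ultrahomogeneity -/

/-- Finite partial isometries of a metric space, as sets of pairs. -/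
abbrev FinitePartialIsometry (X : Type u) [MetricSpace X] : Type u :=
  {S : Finset (X × X) // ∀ a ∈ S, ∀ b ∈ S, dist a.1 b.1 = dist a.2 b.2}

namespace FinitePartialIsometry

variable {U : Type u} [MetricSpace U]

theorem exists_insert (S : FinitePartialIsometry U) (x y : U)
    (h : ∀ a ∈ S.1, dist x a.1 = dist y a.2) :
    ∃ T : FinitePartialIsometry U, (x, y) ∈ T.1 ∧ S ≤ T := by
  classical
  refine ⟨⟨insert (x, y) S.1, ?_⟩, Finset.mem_insert_self _ _, Finset.subset_insert _ _⟩
  intro a ha b hb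
  rcases Finset.mem_insert.1 ha with rfl | ha' <;> rcases Finset.mem_insert.1 hb with rfl | hb'
  · simp
  · exact h b hb'
  · simpa [dist_comm] using h a ha'
  · exact S.2 a ha' b hb'

/-- The finite partial isometries that are defined at `x`. -/
def definedAt (hU : IsUrysohnSpace U) (x : U) : Order.Cofinal (FinitePartialIsometry U) where
  carrier := {S | ∃ y, (x, y) ∈ S.1}
  isCofinal S := by
    obtain ⟨y, hy⟩ := hU.exists_one_point_extension (fun a : S.1 => a.1.1) (fun a => a.1.2)
      (fun a b => S.2 _ a.2 _ b.2) x
    obtain ⟨T, hT, hle⟩ := S.exists_insert x y fun a ha => hy ⟨a, ha⟩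
    exact ⟨T, ⟨y, hT⟩, hle⟩

/-- The finite partial isometries whose range contains `y`. -/
def hits (hU : IsUrysohnSpace U) (y : U) : Order.Cofinal (FinitePartialIsometry U) where
  carrier := {S | ∃ x, (x, y) ∈ S.1}
  isCofinal S := by
    obtain ⟨x, hx⟩ := hU.exists_one_point_extension (fun a : S.1 => a.1.2) (fun a => a.1.1)
      (fun a b => (S.2 _ a.2 _ b.2).symm) y
    obtain ⟨T, hT, hle⟩ := S.exists_insert x y fun a ha => (hx ⟨a, ha⟩).symm
    exact ⟨T, ⟨x, hT⟩, hle⟩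

end FinitePartialIsometry

/-- Two maps with dense range into a complete metric space which induce the same distance differ
by an isometry of that space. -/
theorem exists_isometryEquiv_of_denseRange {X R : Type*} [MetricSpace X] [CompleteSpace X]
    (p q : R → X) (hp : DenseRange p) (hq : DenseRange q)
    (h : ∀ a b, dist (p a) (p b) = dist (q a) (q b)) : ∃ g : X ≃ᵢ X, ∀ a, g (p a) = q a := by
  let : PseudoMetricSpace R := .induced p inferInstance
  have hp' : Isometry p := Isometry.of_dist_eq fun _ _ => rfl
  have hq' : Isometry q := Isometry.of_dist_eq fun a b => (h a b).symm
  let P : AbstractCompletion R :=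
    ⟨X, p, inferInstance, inferInstance, inferInstance, hp'.isUniformInducing, hp⟩
  let Q : AbstractCompletion R :=
    ⟨X, q, inferInstance, inferInstance, inferInstance, hq'.isUniformInducing, hq⟩
  let e : X ≃ᵤ X := P.compareEquiv Q
  have he : ∀ a, e (p a) = q a := fun a => P.compare_coe Q a
  have hiso : ∀ x y, dist (e x) (e y) = dist x y := by
    intro x y
    refine hp.induction_on₂ (p := fun x y => dist (e x) (e y) = dist x y) ?_ ?_ x y
    · exact isClosed_eq ((e.continuous.comp continuous_fst).dist (e.continuous.comp continuous_snd))
        (continuous_fst.dist continuous_snd)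
    · intro a b
      rw [he, he, h]
  exact ⟨⟨e.toEquiv, Isometry.of_dist_eq hiso⟩, he⟩

/-- Back-and-forth: an ideal of finite partial isometries meeting countably many cofinal sets has a
union with dense domain and dense range, which extends by completeness. -/
theorem IsUrysohnSpace.exists_isometryEquiv {U : Type u} [MetricSpace U] (hU : IsUrysohnSpace U)
    {ι : Type*} [Finite ι] (p q : ι → U) (h : ∀ i j, dist (p i) (p j) = dist (q i) (q j)) :
    ∃ g : U ≃ᵢ U, ∀ i, g (p i) = q i := by
  classical
  have := Fintype.ofFinite ι
  have := hU.complete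
  have := hU.separable
  obtain ⟨D, hDc, hD⟩ := TopologicalSpace.exists_countable_dense U
  have : Encodable D := hDc.toEncodable
  let S₀ : FinitePartialIsometry U := ⟨Finset.univ.image fun i => (p i, q i), by
    simp only [Finset.mem_image, Finset.mem_univ, true_and]
    rintro _ ⟨i, rfl⟩ _ ⟨j, rfl⟩
    exact h i j⟩
  let 𝒟 : D ⊕ D → Order.Cofinal (FinitePartialIsometry U) :=
    Sum.elim (fun d => FinitePartialIsometry.definedAt hU d)
      (fun d => FinitePartialIsometry.hits hU d)
  let I := Order.idealOfCofinals S₀ 𝒟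
  let R : Set (U × U) := {a | ∃ S ∈ I, a ∈ S.1}
  obtain ⟨g, hg⟩ := exists_isometryEquiv_of_denseRange (fun a : R => a.1.1) (fun a : R => a.1.2)
    (hD.mono fun d hd => by
      obtain ⟨S, ⟨y, hy⟩, hS⟩ := Order.cofinal_meets_idealOfCofinals S₀ 𝒟 (Sum.inl ⟨d, hd⟩)
      exact ⟨⟨(d, y), S, hS, hy⟩, rfl⟩)
    (hD.mono fun d hd => by
      obtain ⟨S, ⟨y, hy⟩, hS⟩ := Order.cofinal_meets_idealOfCofinals S₀ 𝒟 (Sum.inr ⟨d, hd⟩)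
      exact ⟨⟨(y, d), S, hS, hy⟩, rfl⟩)
    (by
      rintro ⟨a, S, hS, ha⟩ ⟨b, T, hT, hb⟩
      obtain ⟨V, -, hSV, hTV⟩ := I.directed S hS T hT
      exact V.2 a (hSV ha) b (hTV hb))
  exact ⟨g, fun i => hg ⟨(p i, q i), S₀, Order.mem_idealOfCofinals _ _,
    Finset.mem_image_of_mem _ (Finset.mem_univ i)⟩⟩

/-! ### Weighted gluing and approximate homogeneity -/

/-- The distance on two copies of `ι`, metrized by `p` and by `q`, in which the two copies of `k`
are at distance at most `w k`. -/
noncomputable def weightedGlueDist {X ι : Type*} [MetricSpace X] (p q : ι → X) (w : ι → ℝ) :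
    ι ⊕ ι → ι ⊕ ι → ℝ
  | .inl i, .inl j => dist (p i) (p j)
  | .inr i, .inr j => dist (q i) (q j)
  | .inl i, .inr j => ⨅ k, (dist (p i) (p k) + w k + dist (q k) (q j))
  | .inr j, .inl i => ⨅ k, (dist (p i) (p k) + w k + dist (q k) (q j))

/-- The pseudometric space obtained by weighted gluing, when the distortion of the correspondence
between the two copies is controlled by the weights. -/
@[reducible]
noncomputable def weightedGlue {X ι : Type*} [MetricSpace X] [Finite ι] [Nonempty ι] (p q : ι → X)
    (w : ι → ℝ) (hw : ∀ i j, |dist (p i) (p j) - dist (q i) (q j)| ≤ w i + w j) :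
    PseudoMetricSpace (ι ⊕ ι) where
  dist := weightedGlueDist p q w
  dist_self := by rintro (i | i) <;> simp [weightedGlueDist]
  dist_comm := by rintro (i | i) (j | j) <;> simp [weightedGlueDist, dist_comm]
  dist_triangle := by
    have hle : ∀ i j k, ⨅ k, (dist (p i) (p k) + w k + dist (q k) (q j)) ≤
        dist (p i) (p k) + w k + dist (q k) (q j) := fun i j k =>
      ciInf_le (Set.finite_range _).bddBelow k
    have hex : ∀ i j, ∃ k, dist (p i) (p k) + w k + dist (q k) (q j) =
        ⨅ k, (dist (p i) (p k) + w k + dist (q k) (q j)) := fun i j =>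
      exists_eq_ciInf_of_finite
    have hw1 := fun i j => (abs_le.1 (hw i j)).1
    have hw2 := fun i j => (abs_le.1 (hw i j)).2
    rintro (a | a) (b | b) (c | c) <;> simp only [weightedGlueDist]
    · exact dist_triangle _ _ _
    · obtain ⟨k, hk⟩ := hex b c
      linarith [hle a c k, dist_triangle (p a) (p b) (p k)]
    -- Crossing over and back costs `w k + w l`, which by `hw` covers the distortion between the two
    -- copies.
    · obtain ⟨k, hk⟩ := hex a b
      obtain ⟨l, hl⟩ := hex c b
      linarith [hw2 k l, dist_triangle4 (p a) (p k) (p l) (p c), dist_comm (p c) (p l),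
        dist_triangle (q k) (q b) (q l), dist_comm (q b) (q l)]
    · obtain ⟨k, hk⟩ := hex a b
      linarith [hle a c k, dist_triangle (q k) (q b) (q c)]
    · obtain ⟨k, hk⟩ := hex b a
      linarith [hle c a k, dist_triangle (p c) (p b) (p k), dist_comm (p b) (p c)]
    · obtain ⟨k, hk⟩ := hex b a
      obtain ⟨l, hl⟩ := hex b c
      linarith [hw1 k l, dist_triangle4 (q a) (q k) (q l) (q c), dist_comm (q k) (q a),
        dist_triangle (p k) (p b) (p l), dist_comm (p b) (p k)]
    · obtain ⟨k, hk⟩ := hex c b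
      linarith [hle c a k, dist_triangle (q k) (q b) (q a), dist_comm (q a) (q b)]
    · exact dist_triangle _ _ _

/-- Points of the Urysohn space with nearly the same distances to a finite set can be moved to each
other by an isometry which moves the points of that finite set only slightly. -/
theorem IsUrysohnSpace.exists_isometryEquiv_dist_le {U : Type u} [MetricSpace U]
    (hU : IsUrysohnSpace U) (F : Finset U) (x y : U) {δ : ℝ} (hδ : 0 ≤ δ)
    (h : ∀ z ∈ F, |dist x z - dist y z| ≤ δ) :
    ∃ g : U ≃ᵢ U, g x = y ∧ ∀ z ∈ F, dist (g z) z ≤ δ := by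
  -- Weight `0` at `none` will force `g x = y` exactly; weight `δ` lets the points of `F` move.
  let p : Option F → U := fun o => o.elim y (fun z => z)
  let q : Option F → U := fun o => o.elim x (fun z => z)
  let w : Option F → ℝ := fun o => o.elim 0 fun _ => δ
  have hw : ∀ i j, |dist (p i) (p j) - dist (q i) (q j)| ≤ w i + w j := by
    rintro (_ | i) (_ | j)
    · simp [p, q, w]
    · simpa [p, q, w, abs_sub_comm] using h j j.2
    · simpa [p, q, w, abs_sub_comm, dist_comm] using h i i.2
    · simpa [p, q, w] using hδ
  let := weightedGlue p q w hw
  have hcross : ∀ i, dist (Sum.inl i : Option F ⊕ Option F) (Sum.inr i) ≤ w i := by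
    intro i
    refine (ciInf_le (Set.finite_range _).bddBelow i).trans_eq ?_
    simp
  -- Only the left copy is prescribed; on the right, `p` is a dummy value.
  obtain ⟨Φ, hΦ, hext⟩ := hU.exists_isometry_extension (Set.range Sum.inl) (Sum.elim p p) (by
    rintro _ ⟨i, rfl⟩ _ ⟨j, rfl⟩
    rfl)
  obtain ⟨g, hg⟩ := hU.exists_isometryEquiv q (fun i => Φ (Sum.inr i)) fun i j =>
    (hΦ.dist_eq (Sum.inr i) (Sum.inr j)).symm
  have hmove : ∀ i, dist (p i) (g (q i)) ≤ w i := by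
    intro i
    have h1 := hext (Sum.inl i) ⟨i, rfl⟩
    rw [Sum.elim_inl] at h1
    rw [hg, ← h1, hΦ.dist_eq]
    exact hcross i
  refine ⟨g, ?_, fun z hz => ?_⟩
  · exact (dist_le_zero.1 (hmove none)).symm
  · rw [dist_comm]
    exact hmove (some ⟨z, hz⟩)

theorem IsUrysohnSpace.exists_dist_eq {U : Type u} [MetricSpace U] (hU : IsUrysohnSpace U)
    (z : U) {r : ℝ} (hr : 0 ≤ r) : ∃ x, dist x z = r := by
  let : PseudoMetricSpace (ULift.{u} Bool) :=
    .induced (fun b => if b.down then r else 0) (inferInstanceAs (PseudoMetricSpace ℝ))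
  have hd : ∀ a b : ULift.{u} Bool, dist a b =
    dist (if a.down then r else 0) (if b.down then r else 0) := fun _ _ => rfl
  obtain ⟨Φ, hΦ, hext⟩ := hU.exists_isometry_extension {(⟨false⟩ : ULift.{u} Bool)} (fun _ => z)
    (by simp)
  refine ⟨Φ ⟨true⟩, ?_⟩
  rw [← hext ⟨false⟩ rfl, hΦ.dist_eq, hd]
  simpa using hr

/-! ### Samuel compactifications -/

instance samuelUniformSpace {X : Type u} (𝒰 : UniformSpace X) :
    UniformSpace (SamuelCompactification 𝒰) :=
  @UniformSpace.Completion.uniformSpace X (precompactReplica 𝒰)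

instance {X : Type u} (𝒰 : UniformSpace X) : T2Space (SamuelCompactification 𝒰) :=
  letI := precompactReplica 𝒰
  inferInstanceAs (T2Space (UniformSpace.Completion X))

instance {X : Type u} (𝒰 : UniformSpace X) : CompleteSpace (SamuelCompactification 𝒰) :=
  @UniformSpace.Completion.completeSpace X (precompactReplica 𝒰)

theorem denseRange_samuelMap {X : Type u} (𝒰 : UniformSpace X) : DenseRange (samuelMap 𝒰) :=
  @UniformSpace.Completion.denseRange_coe X (precompactReplica 𝒰)

theorem isUniformInducing_samuelMap {X : Type u} (𝒰 : UniformSpace X) :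
    @IsUniformInducing X _ (precompactReplica 𝒰) _ (samuelMap 𝒰) :=
  @UniformSpace.Completion.isUniformInducing_coe X (precompactReplica 𝒰)

theorem uniformContinuous_samuelMap {X : Type u} (𝒰 : UniformSpace X) :
    @UniformContinuous X _ 𝒰 _ (samuelMap 𝒰) := by
  let := precompactReplica 𝒰
  exact (isUniformInducing_samuelMap 𝒰).uniformContinuous.mono_left
    (precompactReplica_isLeast 𝒰).1.1

instance {X : Type u} (𝒰 : UniformSpace X) : CompactSpace (SamuelCompactification 𝒰) := by
  let := precompactReplica 𝒰
  have h1 : TotallyBounded (samuelMap 𝒰 '' Set.univ) :=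
    (precompactReplica_isLeast 𝒰).1.2.image (isUniformInducing_samuelMap 𝒰).uniformContinuous
  have h2 := h1.closure
  rw [Set.image_univ, (denseRange_samuelMap 𝒰).closure_range] at h2
  exact ⟨h2.isCompact_of_isClosed isClosed_univ⟩

/-- A uniformly continuous map with totally bounded range is uniformly continuous for the
precompact replica. -/
theorem uniformContinuous_precompactReplica {X : Type u} {Y : Type*} (𝒰 : UniformSpace X)
    [UniformSpace Y] {f : X → Y} (hf : @UniformContinuous X Y 𝒰 _ f)
    (hr : TotallyBounded (Set.range f)) :
    @UniformContinuous X Y (precompactReplica 𝒰) _ f := by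
  -- The replica is finest, so it suffices that the uniformity pulled back along `f` is totally
  -- bounded.
  rw [@uniformContinuous_iff_le_comap _ _ (precompactReplica 𝒰)]
  refine (precompactReplica_isLeast 𝒰).2 ⟨(@uniformContinuous_iff_le_comap _ _ 𝒰 _ _).1 hf, ?_⟩
  let := UniformSpace.comap f ‹_›
  have := totallyBounded_preimage (f := f) ⟨rfl⟩ hr
  rwa [Set.preimage_range] at this

/-- A uniformly continuous map with totally bounded range into a complete Hausdorff space extends
to the Samuel compactification. -/
theorem exists_samuelExtension {X : Type u} {Y : Type*} (𝒰 : UniformSpace X)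
    [UniformSpace Y] [T2Space Y] [CompleteSpace Y] {f : X → Y}
    (hf : @UniformContinuous X Y 𝒰 _ f) (hr : TotallyBounded (Set.range f)) :
    ∃ F : SamuelCompactification 𝒰 → Y, Continuous F ∧ ∀ x, F (samuelMap 𝒰 x) = f x := by
  let := precompactReplica 𝒰
  exact ⟨UniformSpace.Completion.extension f, UniformSpace.Completion.continuous_extension,
    UniformSpace.Completion.extension_coe (uniformContinuous_precompactReplica 𝒰 hf hr)⟩

theorem exists_samuelMap_extension {X : Type u} (𝒰 : UniformSpace X) {f : X → X}
    (hf : @UniformContinuous X X 𝒰 𝒰 f) :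
    ∃ F : SamuelCompactification 𝒰 → SamuelCompactification 𝒰,
      Continuous F ∧ ∀ x, F (samuelMap 𝒰 x) = samuelMap 𝒰 (f x) :=
  exists_samuelExtension 𝒰
    (@UniformContinuous.comp _ _ _ 𝒰 𝒰 _ _ _ (uniformContinuous_samuelMap 𝒰) hf)
    (isCompact_univ.totallyBounded.subset (Set.subset_univ _))

/-! ### The weak uniformity -/

section WeakUniformity

variable {X : Type u} [MetricSpace X]

theorem tendsto_weakUniformity_iff {α : Type*} {l : Filter α} {f : α → X × X} :
    Filter.Tendsto f l (𝓤[weakUniformity X]) ↔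
      ∀ z, Filter.Tendsto (fun a => dist (dist (f a).1 z) (dist (f a).2 z)) l (𝓝 0) := by
  rw [weakUniformity, iInf_uniformity, Filter.tendsto_iInf]
  refine forall_congr' fun z => ?_
  rw [uniformity_comap, Filter.tendsto_comap_iff, Filter.tendsto_iff_forall_eventually_mem,
    Metric.tendsto_nhds]
  constructor
  · intro h ε hε
    filter_upwards [h _ (Metric.dist_mem_uniformity hε)] with a ha
    simpa [Real.dist_eq] using ha
  · intro h s hs
    obtain ⟨ε, hε, hs⟩ := Metric.mem_uniformity_dist.1 hs
    filter_upwards [h ε hε] with a ha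
    exact hs (by simpa [Real.dist_eq] using ha)

theorem tendsto_dist_dist_weakUniformity (z : X) :
    Filter.Tendsto (fun p : X × X => dist (dist p.1 z) (dist p.2 z)) 𝓤[weakUniformity X] (𝓝 0) :=
  tendsto_weakUniformity_iff.1 Filter.tendsto_id z

theorem uniformContinuous_weakUniformity_isometryEquiv (g : X ≃ᵢ X) :
    @UniformContinuous X X (weakUniformity X) (weakUniformity X) g := by
  refine tendsto_weakUniformity_iff.2 fun z => ?_
  refine (tendsto_dist_dist_weakUniformity (g.symm z)).congr fun p => ?_
  simp only [← g.dist_eq _ (g.symm z), g.apply_symm_apply]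

theorem uniformContinuous_weakUniformity_dist (z : X) :
    @UniformContinuous X ℝ (weakUniformity X) _ fun x => dist x z :=
  tendsto_uniformity_iff_dist_tendsto_zero.2 (tendsto_dist_dist_weakUniformity z)

theorem le_weakUniformity : (inferInstance : UniformSpace X) ≤ weakUniformity X :=
  le_iInf fun _ => uniformContinuous_iff_le_comap.1 (uniformContinuous_id.dist uniformContinuous_const)

theorem continuous_gromovMap : Continuous (gromovMap X) := by
  have h := (uniformContinuous_samuelMap (weakUniformity X)).mono_left
    (le_weakUniformity (X := X))
  exact UniformContinuous.continuous h

/-- Isometries close to the identity displace all points uniformly little in the weak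
uniformity. -/
theorem tendsto_smul_weakUniformity :
    Filter.Tendsto (fun p : (X ≃ᵢ X) × X => (p.1 p.2, p.2)) (𝓝 1 ×ˢ ⊤) 𝓤[weakUniformity X] := by
  refine tendsto_weakUniformity_iff.2 fun z => ?_
  have h1 : Filter.Tendsto (fun p : (X ≃ᵢ X) × X => dist z (p.1 z)) (𝓝 1 ×ˢ ⊤) (𝓝 0) := by
    have h2 : Filter.Tendsto (fun g : X ≃ᵢ X => dist z (g z)) (𝓝 1) (𝓝 0) := by
      have h3 : Continuous fun g : X ≃ᵢ X => dist z (g z) :=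
        continuous_const.dist (iso_continuous_apply z)
      simpa using h3.tendsto 1
    exact h2.comp Filter.tendsto_fst
  refine squeeze_zero (fun _ => dist_nonneg) (fun p => ?_) h1
  rw [dist_comm, ← p.1.dist_eq p.2 z]
  exact dist_dist_dist_le_right _ _ _ |>.trans_eq (by rw [dist_comm])

/-- The basic neighbourhoods of the identity for the topology of pointwise convergence. -/
theorem exists_finset_of_mem_nhds_one {s : Set (X ≃ᵢ X)} (hs : s ∈ 𝓝 1) :
    ∃ (F : Finset X) (ε : ℝ), 0 < ε ∧ ∀ g : X ≃ᵢ X, (∀ z ∈ F, dist (g z) z < ε) → g ∈ s := by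
  rw [nhds_induced, Filter.mem_comap] at hs
  obtain ⟨t, ht, hts⟩ := hs
  rw [nhds_pi, Filter.mem_pi'] at ht
  obtain ⟨F, V, hV, hVt⟩ := ht
  have h1 : ∀ᶠ ε in 𝓝[>] (0 : ℝ), ∀ z ∈ F, Metric.ball z ε ⊆ V z := by
    refine (Filter.eventually_all_finset F).2 fun z _ => ?_
    obtain ⟨r, hr, hrV⟩ := Metric.mem_nhds_iff.1 (hV z)
    filter_upwards [Ioo_mem_nhdsGT hr] with ε hε
    exact (Metric.ball_subset_ball hε.2.le).trans hrV
  obtain ⟨ε, hε, hε0⟩ := (h1.and self_mem_nhdsWithin).exists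
  exact ⟨F, ε, hε0, fun g hg => hts (hVt fun z hz => hε z hz (hg z hz))⟩

end WeakUniformity

/-! ### The action of the isometry group on the Gromov compactification -/

section Action

variable {X : Type u} [MetricSpace X]

/-- The extension of an isometry to the Gromov compactification. -/
noncomputable def gromovExtension (g : X ≃ᵢ X) :
    GromovCompactification X → GromovCompactification X :=
  (exists_samuelMap_extension _ (uniformContinuous_weakUniformity_isometryEquiv g)).choose

theorem continuous_gromovExtension (g : X ≃ᵢ X) : Continuous (gromovExtension g) :=
  (exists_samuelMap_extension _
    (uniformContinuous_weakUniformity_isometryEquiv g)).choose_spec.1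

theorem gromovExtension_gromovMap (g : X ≃ᵢ X) (x : X) :
    gromovExtension g (gromovMap X x) = gromovMap X (g x) :=
  (exists_samuelMap_extension _
    (uniformContinuous_weakUniformity_isometryEquiv g)).choose_spec.2 x

/-- The action of the isometry group on the Gromov compactification. -/
noncomputable instance gromovMulAction : MulAction (X ≃ᵢ X) (GromovCompactification X) where
  smul := gromovExtension
  one_smul k := by
    refine (denseRange_samuelMap (weakUniformity X)).induction_on k
      (isClosed_eq (continuous_gromovExtension 1) continuous_id) fun x => ?_
    exact gromovExtension_gromovMap 1 x
  mul_smul g h k := by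
    refine (denseRange_samuelMap (weakUniformity X)).induction_on k
      (isClosed_eq (continuous_gromovExtension (g * h))
        ((continuous_gromovExtension g).comp (continuous_gromovExtension h))) fun x => ?_
    change gromovExtension (g * h) (gromovMap X x) =
      gromovExtension g (gromovExtension h (gromovMap X x))
    simp only [gromovExtension_gromovMap]
    rfl

theorem smul_gromovMap (g : X ≃ᵢ X) (x : X) : g • gromovMap X x = gromovMap X (g x) :=
  gromovExtension_gromovMap g x

theorem continuous_gromov_const_smul (g : X ≃ᵢ X) :
    Continuous fun k : GromovCompactification X => g • k :=
  continuous_gromovExtension g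

/-- The estimate on `X` is uniform in the point, so closed entourages carry it over from the dense
image. -/
theorem eventually_smul_mem_uniformity {V : Set (GromovCompactification X × GromovCompactification X)}
    (hV : V ∈ 𝓤 (GromovCompactification X)) :
    ∀ᶠ g in 𝓝 (1 : X ≃ᵢ X), ∀ k : GromovCompactification X, (g • k, k) ∈ V := by
  obtain ⟨W, ⟨hW, hWc⟩, hWV⟩ := uniformity_hasBasis_closed.mem_iff.1 hV
  have h1 := (Filter.Tendsto.comp (uniformContinuous_samuelMap (weakUniformity X))
    (tendsto_smul_weakUniformity (X := X))).eventually hW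
  have h2 := Filter.Eventually.curry h1
  filter_upwards [h2] with g hg k
  refine hWV ((denseRange_samuelMap (weakUniformity X)).induction_on k ?_ fun x => ?_)
  · exact hWc.preimage ((continuous_gromov_const_smul g).prodMk continuous_id)
  · have := Filter.eventually_top.1 hg x
    rw [← gromovMap, smul_gromovMap]
    exact this

instance : ContinuousSMul (X ≃ᵢ X) (GromovCompactification X) where
  continuous_smul := by
    have h1 : ∀ k : GromovCompactification X, Filter.Tendsto
        (fun p : (X ≃ᵢ X) × GromovCompactification X => p.1 • p.2) (𝓝 (1, k)) (𝓝 k) := by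
      intro k
      have hu : Filter.Tendsto (fun p : (X ≃ᵢ X) × GromovCompactification X => (p.1 • p.2, p.2))
          (𝓝 (1, k)) (𝓤 _) := by
        intro V hV
        rw [nhds_prod_eq, Filter.mem_map]
        filter_upwards [(eventually_smul_mem_uniformity hV).prod_inl (𝓝 k)] with p hp using hp p.2
      have h2 : Filter.Tendsto (fun p : (X ≃ᵢ X) × GromovCompactification X => p.2)
          (𝓝 (1, k)) (𝓝 k) := continuous_snd.tendsto _
      exact h2.congr_uniformity (tendsto_swap_uniformity.comp hu)
    rw [continuous_iff_continuousAt]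
    rintro ⟨g, k⟩
    -- Translation by `g⁻¹` reduces continuity at `(g, k)` to continuity at `(1, k)`.
    have h3 : Filter.Tendsto (fun p : (X ≃ᵢ X) × GromovCompactification X => (g⁻¹ * p.1, p.2))
        (𝓝 (g, k)) (𝓝 (1, k)) := by
      have : Continuous fun p : (X ≃ᵢ X) × GromovCompactification X => (g⁻¹ * p.1, p.2) := by
        fun_prop
      simpa using this.tendsto (g, k)
    refine (((continuous_gromov_const_smul g).tendsto k).comp ((h1 k).comp h3)).congr fun p => ?_
    simp [smul_smul]

theorem isEquivariantCompactification_gromovMap :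
    IsEquivariantCompactification (X ≃ᵢ X) (gromovMap X) where
  compact := inferInstance
  hausdorff := inferInstance
  continuous_action := inferInstance
  continuous := continuous_gromovMap
  denseRange := denseRange_samuelMap _
  equivariant g x := (smul_gromovMap g x).symm

end Action

/-! ### Maximality -/

/-- Group elements close to the identity displace the points of a compact `G`-space uniformly
little. -/
theorem eventually_forall_smul_mem_uniformity {G L : Type*} [Group G] [TopologicalSpace G]
    [UniformSpace L] [CompactSpace L] [MulAction G L] [ContinuousSMul G L] {V : Set (L × L)}
    (hV : V ∈ 𝓤 L) : ∀ᶠ g in 𝓝 (1 : G), ∀ k : L, (k, g • k) ∈ V := by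
  have := isCompact_univ.eventually_forall_of_forall_eventually (x₀ := (1 : G)) (K := Set.univ)
    (P := fun g (k : L) => (k, g • k) ∈ V) fun k _ => by
      have h1 : Continuous fun p : G × L => (p.2, p.1 • p.2) := by fun_prop
      refine (h1.tendsto (1, k)).eventually (p := fun q => q ∈ V) ?_
      rw [one_smul]
      exact nhds_le_uniformity k hV
  simpa using this

theorem IsUrysohnSpace.uniformContinuous_weakUniformity {U : Type u} [MetricSpace U]
    (hU : IsUrysohnSpace U) {L : Type*} [UniformSpace L] [CompactSpace L] [MulAction (U ≃ᵢ U) L]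
    [ContinuousSMul (U ≃ᵢ U) L] {μ : U → L} (hμ : ∀ (g : U ≃ᵢ U) x, μ (g • x) = g • μ x) :
    @UniformContinuous U L (weakUniformity U) _ μ := by
  intro V hV
  obtain ⟨F, ε, hε, hF⟩ := exists_finset_of_mem_nhds_one
    (eventually_forall_smul_mem_uniformity (G := U ≃ᵢ U) hV)
  -- Half of `ε`, because the isometry found below satisfies only a non-strict bound.
  have h1 : ∀ᶠ p in 𝓤[weakUniformity U], ∀ z ∈ F, dist (dist p.1 z) (dist p.2 z) < ε / 2 :=
    (Filter.eventually_all_finset F).2 fun z _ =>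
      (tendsto_dist_dist_weakUniformity z).eventually_lt_const (half_pos hε)
  refine Filter.mem_map.2 ?_
  filter_upwards [h1] with ⟨x, y⟩ hxy
  obtain ⟨g, rfl, hg⟩ := hU.exists_isometryEquiv_dist_le F x y (half_pos hε).le
    fun z hz => (hxy z hz).le
  have h2 := hF g (fun z hz => (hg z hz).trans_lt (half_lt_self hε)) (μ x)
  rwa [← hμ] at h2

theorem IsUrysohnSpace.isGreatestEquivariantCompactification_gromovMap {U : Type u} [MetricSpace U]
    (hU : IsUrysohnSpace U) :
    IsGreatestEquivariantCompactification.{v} (U ≃ᵢ U) (gromovMap U) where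
  isEquivariantCompactification := isEquivariantCompactification_gromovMap
  factors L _ _ μ hμ := by
    have := hμ.compact
    have := hμ.hausdorff
    have := hμ.continuous_action
    let : UniformSpace L := uniformSpaceOfCompactR1
    obtain ⟨π, hπ, hπμ⟩ := exists_samuelExtension (weakUniformity U)
      (hU.uniformContinuous_weakUniformity hμ.equivariant)
      (isCompact_univ.totallyBounded.subset (Set.subset_univ _))
    refine ⟨π, hπ, fun g k => ?_, hπμ⟩
    refine (denseRange_samuelMap (weakUniformity U)).induction_on k
      (isClosed_eq (hπ.comp (continuous_gromov_const_smul g)) (hπ.const_smul g)) fun x => ?_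
    rw [← gromovMap, smul_gromovMap, hπμ, hπμ, ← hμ.equivariant]
    rfl

/-! ### Non-metrizability -/

/-- A bounded uniformly continuous function of the distance to a point extends to the Gromov
compactification. -/
theorem exists_gromovExtension_comp_dist {X : Type u} [MetricSpace X] (z : X) {h : ℝ → ℝ}
    (hh : UniformContinuous h) (hb : Bornology.IsBounded (Set.range h)) :
    ∃ F : GromovCompactification X → ℝ, Continuous F ∧ ∀ x, F (gromovMap X x) = h (dist x z) :=
  exists_samuelExtension (weakUniformity X)
    (@UniformContinuous.comp _ _ _ (weakUniformity X) _ _ _ _ hh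
      (uniformContinuous_weakUniformity_dist z))
    ((hb.subset (Set.range_comp_subset_range _ h)).isCompact_closure.totallyBounded.subset
      subset_closure)

theorem IsUrysohnSpace.not_metrizableSpace_gromovCompactification {U : Type u} [MetricSpace U]
    (hU : IsUrysohnSpace U) : ¬ TopologicalSpace.MetrizableSpace (GromovCompactification U) := by
  intro hm
  have : Nonempty U := by
    by_contra hne
    rw [not_nonempty_iff] at hne
    have := hU.ediam_eq_top
    simp [Set.eq_empty_of_isEmpty] at this
  obtain ⟨z⟩ := this
  choose x hx using fun n : ℕ => hU.exists_dist_eq z n.cast_nonneg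
  -- Metrizability enters here, through sequential compactness.
  obtain ⟨k, φ, hφ, hlim⟩ := CompactSpace.tendsto_subseq fun n => gromovMap U (x n)
  -- The truncated distance to `A` is `0` at even terms of the subsequence and `1` at odd ones,
  -- since distinct integers are at distance at least `1`.
  let A : Set ℝ := Set.range fun m => (φ (2 * m) : ℝ)
  obtain ⟨F, hF, hFx⟩ := exists_gromovExtension_comp_dist z 
    (h := fun t => min 1 (Metric.infDist t A))
    (LipschitzWith.uniformContinuous ((Metric.lipschitz_infDist_pt A).const_min 1))
    ((Metric.isBounded_Icc 0 1).subset (by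
      rintro _ ⟨t, rfl⟩
      exact ⟨le_min zero_le_one Metric.infDist_nonneg, min_le_left _ _⟩))
  have hFlim : Filter.Tendsto (fun n => min 1 (Metric.infDist (φ n : ℝ) A)) Filter.atTop
      (𝓝 (F k)) := by
    refine ((hF.tendsto k).comp hlim).congr fun n => ?_
    simp only [Function.comp_apply, hFx, hx]
  have h0 : Filter.Tendsto (fun m : ℕ => 2 * m) Filter.atTop Filter.atTop :=
    Filter.tendsto_atTop_mono (fun m => (by omega : m ≤ 2 * m)) Filter.tendsto_id
  have h1 : Filter.Tendsto (fun m : ℕ => 2 * m + 1) Filter.atTop Filter.atTop :=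
    Filter.tendsto_atTop_mono (fun m => (by omega : m ≤ 2 * m + 1)) Filter.tendsto_id
  have heven : F k = 0 := by
    refine tendsto_nhds_unique (hFlim.comp h0) (tendsto_const_nhds.congr fun m => ?_)
    have : Metric.infDist (φ (2 * m) : ℝ) A = 0 := Metric.infDist_zero_of_mem ⟨m, rfl⟩
    simp [this]
  have hodd : F k = 1 := by
    refine tendsto_nhds_unique (hFlim.comp h1) (tendsto_const_nhds.congr fun m => ?_)
    refine (min_eq_left ((Metric.le_infDist (Set.range_nonempty _)).2 ?_)).symm
    rintro _ ⟨l, rfl⟩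
    have hne : φ (2 * m + 1) ≠ φ (2 * l) := fun h => by
      have := hφ.injective h
      omega
    rw [Nat.dist_cast_real]
    exact Nat.pairwise_one_le_dist hne
  linarith

theorem theorem3p6 {U : Type u} [MetricSpace U] (hU : IsUrysohnSpace U) :
    (∃ _ : MulAction (U ≃ᵢ U) (GromovCompactification U),
      IsGreatestEquivariantCompactification.{v} (U ≃ᵢ U) (gromovMap U)) ∧
    ¬ TopologicalSpace.MetrizableSpace (GromovCompactification U) :=
  ⟨⟨inferInstance, hU.isGreatestEquivariantCompactification_gromovMap⟩,
    hU.not_metrizableSpace_gromovCompactification⟩
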